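/- Let $(\Omega,\mathcal F,\mu)$ be a semi-finite measure space, i.e. every measurable set of infinite measure contains a measurable subset of finite positive measure. Let $L^0(\mu)$ be the vector lattice of real measurable functions modulo $\mu$-a.e. equality. Let $X$ be a Banach function space over $\mu$, i.e. an order ideal of $L^0(\mu)$ (a linear subspace such that $|f|\le|g|$, $g\in X$ imply $f\in X$) with a complete norm satisfying $\|f\|\le\|g\|$ whenever $|f|\le|g|$. Assume that $X$ is order continuous ($f_\alpha\downarrow 0$ in $X$ implies $\|f_\alpha\|\to0$ for every net) and order dense in $L^0(\mu)$ (for every $0<g\in L^0(\mu)$ there is $f\in X$ with $0<f\le g$). Then the following statements are equivalent. 1. $X$ is norm separable. 2. $X$ is separable in the topology of local convergence in measure (the topology in which $f_\lambda\to f$ if and only if $f_\lambda\chi_A\to f\chi_A$ in measure for every $A\in\mathcal F$ with $\mu(A)<\infty$). 3. The measure $\mu$ is $\sigma$-finite, and for every $A\in\mathcal F$ with $\mu(A)<\infty$ the semi-metric space $(\mathcal F|_A,d_\mu)$ is separable, where $\mathcal F|_A=\{B\in\mathcal F: B\subseteq A\}$ and $d_\mu(B,C)=\mu(B\setminus C)+\mu(C\setminus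 B)$. 4. The measure $\mu$ is $\sigma$-finite, and for every $A\in\mathcal F$ with $\mu(A)<\infty$ the space $X_A=\{\chi_A f: f\in X\}$ is norm separable. 5. $X$ contains a function that is strictly positive $\mu$-almost everywhere, and for every such $f\in X$ the set $C_f=\{x\in X: 0\le x\le f,\ |x|\wedge|f-x|=0\}$ of components of $f$ is separable in the metric $\rho$ induced by the norm of $X$. -/

import Mathlib

open MeasureTheory Filter Topology Set
open scoped ENNReal

noncomputable section

/-- A measure is semi-finite if every measurable set of infinite measure contains a measurable
subset of finite positive measure. -/
def IsSemifiniteMeasure {Ω : Type*} [MeasurableSpace Ω] (μ : Measure Ω) : Prop :=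
  ∀ B : Set Ω, MeasurableSet B → μ B = ∞ →
    ∃ C : Set Ω, C ⊆ B ∧ MeasurableSet C ∧ 0 < μ C ∧ μ C < ∞

/-- A Banach function space over `μ`: an order ideal `carrier` of the vector lattice `L⁰(μ)` of
(classes of) real measurable functions, with a complete lattice norm on it. -/
structure BanachFunctionSpace {Ω : Type*} [MeasurableSpace Ω] (μ : Measure Ω) where
  /-- the underlying linear subspace of `L⁰(μ)` -/
  carrier : Submodule ℝ (Ω →ₘ[μ] ℝ)
  ideal : ∀ f g : Ω →ₘ[μ] ℝ, g ∈ carrier → |f| ≤ |g| → f ∈ carrier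
  /-- the norm -/
  norm : carrier → ℝ
  norm_nonneg : ∀ f, 0 ≤ norm f
  norm_eq_zero_iff : ∀ f, norm f = 0 ↔ f = 0
  norm_smul : ∀ (c : ℝ) (f : carrier), norm (c • f) = |c| * norm f
  norm_add_le : ∀ f g, norm (f + g) ≤ norm f + norm g
  norm_mono : ∀ f g : carrier, |(f : Ω →ₘ[μ] ℝ)| ≤ |(g : Ω →ₘ[μ] ℝ)| → norm f ≤ norm g
  complete : ∀ u : ℕ → carrier,
    (∀ ε : ℝ, 0 < ε → ∃ N, ∀ m ≥ N, ∀ n ≥ N, norm (u m - u n) < ε) →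
      ∃ f : carrier, ∀ ε : ℝ, 0 < ε → ∃ N, ∀ n ≥ N, norm (u n - f) < ε

/-- The topology of local convergence in measure on `L⁰(μ)`: the sets
`{g | μ {x ∈ A | ε ≤ |g x - f x|} < ε}`, for `A` measurable of finite measure and `ε > 0`, form a
neighbourhood base at `f`. -/
@[reducible] def localMeasureTopology {Ω : Type*} [MeasurableSpace Ω] (μ : Measure Ω) :
    TopologicalSpace (Ω →ₘ[μ] ℝ) where
  IsOpen U := ∀ f ∈ U, ∃ A : Set Ω, MeasurableSet A ∧ μ A < ∞ ∧ ∃ ε : ℝ, 0 < ε ∧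
    ∀ g : Ω →ₘ[μ] ℝ, μ {x ∈ A | ε ≤ |g x - f x|} < ENNReal.ofReal ε → g ∈ U
  isOpen_univ f _ := ⟨∅, MeasurableSet.empty, by simp, 1, one_pos, fun _ _ => trivial⟩
  isOpen_inter U V hU hV f hf := by
    obtain ⟨A, hA, hA', ε, hε, h⟩ := hU f hf.1
    obtain ⟨B, hB, hB', δ, hδ, k⟩ := hV f hf.2
    refine ⟨A ∪ B, hA.union hB, measure_union_lt_top hA' hB', min ε δ, lt_min hε hδ,
      fun g hg => ⟨h g ?_, k g ?_⟩⟩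
    · exact (measure_mono (t := {x ∈ A ∪ B | min ε δ ≤ |g x - f x|})
        fun x hx => ⟨Or.inl hx.1, (min_le_left _ _).trans hx.2⟩).trans_lt
        (hg.trans_le (ENNReal.ofReal_le_ofReal (min_le_left _ _)))
    · exact (measure_mono (t := {x ∈ A ∪ B | min ε δ ≤ |g x - f x|})
        fun x hx => ⟨Or.inr hx.1, (min_le_right _ _).trans hx.2⟩).trans_lt
        (hg.trans_le (ENNReal.ofReal_le_ofReal (min_le_right _ _)))
  isOpen_sUnion S hS f hf := by
    obtain ⟨U, hU, hfU⟩ := hf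
    obtain ⟨A, hA, hA', ε, hε, h⟩ := hS U hU f hfU
    exact ⟨A, hA, hA', ε, hε, fun g hg => ⟨U, hU, h g hg⟩⟩

/-- Convergence in `localMeasureTopology μ` is convergence in measure on every set of finite
measure. -/
theorem tendsto_localMeasureTopology_iff {Ω ι : Type*} [MeasurableSpace Ω] {μ : Measure Ω}
    (l : Filter ι) (u : ι → Ω →ₘ[μ] ℝ) (f : Ω →ₘ[μ] ℝ) :
    Tendsto u l (@nhds _ (localMeasureTopology μ) f) ↔
      ∀ A : Set Ω, MeasurableSet A → μ A < ∞ →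
        TendstoInMeasure (μ.restrict A) (fun i => ⇑(u i)) l f := by
  let _ : TopologicalSpace (Ω →ₘ[μ] ℝ) := localMeasureTopology μ
  have key : ∀ (f : Ω →ₘ[μ] ℝ) (A : Set Ω), MeasurableSet A → μ A < ∞ → ∀ ε : ℝ, 0 < ε →
      {g : Ω →ₘ[μ] ℝ | μ {x ∈ A | ε ≤ |g x - f x|} < ENNReal.ofReal ε} ∈ 𝓝 f := by
    intro f A hA hA' ε hε
    let V : ℝ → (Ω →ₘ[μ] ℝ) → Set (Ω →ₘ[μ] ℝ) := fun δ g =>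
      {h | μ {x ∈ A | δ ≤ |h x - g x|} < ENNReal.ofReal δ}
    have self : ∀ δ : ℝ, 0 < δ → ∀ g, g ∈ V δ g := by
      intro δ hδ g
      simp [V, not_le.mpr hδ, hδ]
    refine mem_nhds_iff.2 ⟨{g | ∃ δ : ℝ, 0 < δ ∧ V δ g ⊆ V ε f}, ?_, ?_, ε, hε, subset_rfl⟩
    · rintro g ⟨δ, hδ, h⟩
      exact h (self δ hδ g)
    · rintro g ⟨δ, hδ, h⟩
      refine ⟨A, hA, hA', δ / 2, half_pos hδ, fun k hk => ⟨δ / 2, half_pos hδ, fun m hm => h ?_⟩⟩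
      have hsub : {x ∈ A | δ ≤ |m x - g x|} ⊆
          {x ∈ A | δ / 2 ≤ |m x - k x|} ∪ {x ∈ A | δ / 2 ≤ |k x - g x|} := by
        rintro x ⟨hx, hx'⟩
        by_contra hcon
        simp only [mem_union, mem_ofPred_eq, hx, true_and, not_or, not_le] at hcon
        linarith [abs_sub_le (m x) (k x) (g x)]
      calc μ {x ∈ A | δ ≤ |m x - g x|} ≤ _ := (measure_mono hsub).trans (measure_union_le _ _)
        _ < ENNReal.ofReal (δ / 2) + ENNReal.ofReal (δ / 2) := ENNReal.add_lt_add hm hk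
        _ = ENNReal.ofReal δ := by
          rw [← ENNReal.ofReal_add (half_pos hδ).le (half_pos hδ).le, add_halves]
  have restr : ∀ (A : Set Ω), MeasurableSet A → ∀ (ε : ℝ) (g : Ω →ₘ[μ] ℝ),
      μ.restrict A {x | ε ≤ ‖g x - f x‖} = μ {x ∈ A | ε ≤ |g x - f x|} := by
    intro A hA ε g
    rw [Measure.restrict_apply' hA, inter_comm]
    rfl
  constructor
  · intro h A hA hA'
    rw [tendstoInMeasure_iff_norm]
    intro ε hε
    simp_rw [restr A hA]
    rw [ENNReal.tendsto_nhds_zero]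
    intro η hη
    obtain ⟨r, hr, hrη⟩ : ∃ r : ℝ, 0 < r ∧ ENNReal.ofReal r ≤ η := by
      rcases eq_or_ne η ∞ with rfl | hη'
      · exact ⟨1, one_pos, le_top⟩
      · exact ⟨η.toReal, ENNReal.toReal_pos hη.ne' hη', (ENNReal.ofReal_toReal hη').le⟩
    filter_upwards [h (key f A hA hA' (min ε r) (lt_min hε hr))] with i hi
    exact (measure_mono (t := {x ∈ A | min ε r ≤ |u i x - f x|})
      fun x hx => ⟨hx.1, (min_le_left _ _).trans hx.2⟩).trans
        (hi.le.trans ((ENNReal.ofReal_le_ofReal (min_le_right _ _)).trans hrη))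
  · intro h
    rw [tendsto_nhds]
    intro U hU hf
    obtain ⟨A, hA, hA', ε, hε, hV⟩ := hU f hf
    have h1 := (tendstoInMeasure_iff_norm.1 (h A hA hA')) ε hε
    simp_rw [restr A hA] at h1
    filter_upwards [h1.eventually_lt_const (ENNReal.ofReal_pos.2 hε)] with i hi
    exact hV _ hi

namespace BanachFunctionSpace

instance instNorm {Ω : Type*} [MeasurableSpace Ω] {μ : Measure Ω} (X : BanachFunctionSpace μ) :
    Norm X.carrier := ⟨X.norm⟩

theorem normCore {Ω : Type*} [MeasurableSpace Ω] {μ : Measure Ω} (X : BanachFunctionSpace μ) :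
    NormedSpace.Core ℝ X.carrier where
  norm_nonneg := X.norm_nonneg
  norm_smul := X.norm_smul
  norm_triangle := X.norm_add_le
  norm_eq_zero_iff := X.norm_eq_zero_iff

/-- The norm topology of `X`. -/
instance instNormedAddCommGroup {Ω : Type*} [MeasurableSpace Ω] {μ : Measure Ω}
    (X : BanachFunctionSpace μ) : NormedAddCommGroup X.carrier :=
  NormedAddCommGroup.ofCore X.normCore

/-- The norm is order continuous: every (downward directed) net decreasing to `0` in `X` converges
to `0` in norm. A decreasing net enters through its range `D`, indexed by itself. -/
def IsOrderContinuous {Ω : Type*} [MeasurableSpace Ω] {μ : Measure Ω}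
    (X : BanachFunctionSpace μ) : Prop :=
  ∀ D : Set X.carrier, D.Nonempty → DirectedOn (· ≥ ·) D → IsGLB D 0 →
    Tendsto (fun f : D => ‖(f : X.carrier)‖) atBot (𝓝 0)

/-- `X` is order dense in `L⁰(μ)`. -/
def IsOrderDense {Ω : Type*} [MeasurableSpace Ω] {μ : Measure Ω}
    (X : BanachFunctionSpace μ) : Prop :=
  ∀ g : Ω →ₘ[μ] ℝ, 0 < g → ∃ f ∈ X.carrier, 0 < f ∧ f ≤ g

/-- The topology of local convergence in measure on `X`, induced from `L⁰(μ)`. -/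
@[reducible] def localMeasureTopology {Ω : Type*} [MeasurableSpace Ω] {μ : Measure Ω}
    (X : BanachFunctionSpace μ) : TopologicalSpace X.carrier :=
  (_root_.localMeasureTopology μ).induced Subtype.val

/-- `X_A = {χ_A f : f ∈ X}`, as a subset of `X`. -/
def restrictTo {Ω : Type*} [MeasurableSpace Ω] {μ : Measure Ω}
    (X : BanachFunctionSpace μ) (A : Set Ω) : Set X.carrier :=
  {g | ∃ f : X.carrier,
    ⇑(g : Ω →ₘ[μ] ℝ) =ᵐ[μ] A.indicator (f : Ω →ₘ[μ] ℝ)}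

/-- The set `C_u` of components of `u`: all `x` with `0 ≤ x ≤ u` and `|x| ∧ |u - x| = 0`. -/
def components {Ω : Type*} [MeasurableSpace Ω] {μ : Measure Ω}
    (X : BanachFunctionSpace μ) (u : X.carrier) : Set X.carrier :=
  {x | 0 ≤ x ∧ x ≤ u ∧ |(x : Ω →ₘ[μ] ℝ)| ⊓ |(u : Ω →ₘ[μ] ℝ) - (x : Ω →ₘ[μ] ℝ)| = 0}

/-- `f` is strictly positive almost everywhere. -/
def IsStrictlyPositive {Ω : Type*} [MeasurableSpace Ω] {μ : Measure Ω}
    (X : BanachFunctionSpace μ) (f : X.carrier) : Prop :=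
  ∀ᵐ x ∂μ, 0 < (f : Ω →ₘ[μ] ℝ) x

end BanachFunctionSpace

end

namespace BanachFunctionSpace

variable {Ω : Type*} [MeasurableSpace Ω] {μ : Measure Ω} {X : BanachFunctionSpace μ}

/-! Everything is reduced to the functions `χ_B e`, where `e ∈ X` is strictly positive a.e. Order
continuity gives dominated convergence in `X` (`IsOrderContinuous.tendsto_zero`). Hence `B ↦ χ_B e`
is continuous for the measure distance, and these functions span a dense subspace (approximate `f /
e` by simple functions). So `X` is norm separable as soon as the set of all `χ_B e` is.

Norm convergence implies local convergence in measure, which gives 1 → 2. For 2 → 3, the joint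
support of a dense sequence is carried by countably many sets of finite measure, and by order
density it has null complement, so `μ` is σ-finite; then `e` exists, and a measurable `B ⊆ A` is
recovered up to small measure from an approximation `d` of `χ_B e` as `{x ∈ A | d x > e x / 2}`. For
3 → 1, exhaust the space by sets of finite measure and use the continuity of `B ↦ χ_B e`. Statements
4 and 5 follow from 1 because separability of a metric space passes to subsets. Conversely, 4 gives
1 by exhaustion, and 5 gives 1 because every `χ_B e` is a component of `e`. -/

noncomputable instance instNormedSpace (X : BanachFunctionSpace μ) : NormedSpace ℝ X.carrier :=
  NormedSpace.ofCore X.normCore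

instance instCompleteSpace (X : BanachFunctionSpace μ) : CompleteSpace X.carrier := by
  refine Metric.complete_of_cauchySeq_tendsto fun u hu => ?_
  rw [Metric.cauchySeq_iff] at hu
  obtain ⟨f, hf⟩ := X.complete u fun ε hε => by
    obtain ⟨N, hN⟩ := hu ε hε
    exact ⟨N, fun m hm n hn => by simpa [dist_eq_norm] using! hN m hm n hn⟩
  refine ⟨f, Metric.tendsto_atTop.2 fun ε hε => ?_⟩
  obtain ⟨N, hN⟩ := hf ε hε
  exact ⟨N, fun n hn => by simpa [dist_eq_norm] using! hN n hn⟩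

/-! ### Elements of `X` as functions up to null sets. -/

theorem ext_ae {f g : X.carrier} (h : ⇑f.1 =ᵐ[μ] ⇑g.1) : f = g :=
  Subtype.ext (AEEqFun.ext h)

theorem coeFn_sub (f g : X.carrier) : ⇑(f - g).1 =ᵐ[μ] fun x => f.1 x - g.1 x :=
  AEEqFun.coeFn_sub f.1 g.1

theorem coeFn_add (f g : X.carrier) : ⇑(f + g).1 =ᵐ[μ] fun x => f.1 x + g.1 x :=
  AEEqFun.coeFn_add f.1 g.1

theorem coeFn_smul (c : ℝ) (f : X.carrier) : ⇑(c • f).1 =ᵐ[μ] fun x => c * f.1 x :=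
  AEEqFun.coeFn_smul c f.1

theorem coeFn_zero : ⇑(0 : X.carrier).1 =ᵐ[μ] fun _ => 0 :=
  AEEqFun.coeFn_zero

theorem abs_le_abs_iff_ae {f g : Ω →ₘ[μ] ℝ} : |f| ≤ |g| ↔ ∀ᵐ x ∂μ, |f x| ≤ |g x| := by
  rw [← AEEqFun.coeFn_le]
  refine eventually_congr ?_
  filter_upwards [AEEqFun.coeFn_abs f, AEEqFun.coeFn_abs g] with x hf hg
  rw [hf, hg]

theorem norm_le_of_ae {f g : X.carrier} (h : ∀ᵐ x ∂μ, |f.1 x| ≤ |g.1 x|) : ‖f‖ ≤ ‖g‖ :=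
  X.norm_mono f g (abs_le_abs_iff_ae.2 h)

/-- A measurable function dominated by an element of `X` defines an element of `X`. -/
theorem exists_coeFn_eq (g : X.carrier) {f : Ω → ℝ} (hf : AEStronglyMeasurable f μ)
    (h : ∀ᵐ x ∂μ, |f x| ≤ |g.1 x|) : ∃ k : X.carrier, ⇑k.1 =ᵐ[μ] f := by
  refine ⟨⟨AEEqFun.mk f hf, X.ideal _ g.1 g.2 (abs_le_abs_iff_ae.2 ?_)⟩, AEEqFun.coeFn_mk f hf⟩
  filter_upwards [h, AEEqFun.coeFn_mk f hf] with x hx hx'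
  rwa [hx']

theorem coeFn_measurable (f : X.carrier) : Measurable ⇑f.1 :=
  f.1.measurable

/-- The restriction `χ_B f` of `f` to a measurable set `B`. -/
theorem exists_indicator (f : X.carrier) {B : Set Ω} (hB : MeasurableSet B) :
    ∃ k : X.carrier, ⇑k.1 =ᵐ[μ] B.indicator f.1 :=
  exists_coeFn_eq f ((coeFn_measurable f).indicator hB).aestronglyMeasurable
    (.of_forall fun x => by
      simpa [Real.norm_eq_abs] using norm_indicator_le_norm_self (s := B) (⇑f.1) x)

theorem exists_abs (f : X.carrier) : ∃ k : X.carrier, ⇑k.1 =ᵐ[μ] fun x => |f.1 x| :=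
  exists_coeFn_eq f (coeFn_measurable f).norm.aestronglyMeasurable (.of_forall fun x => by simp)

theorem le_iff_ae {f g : X.carrier} : f ≤ g ↔ ∀ᵐ x ∂μ, f.1 x ≤ g.1 x :=
  (AEEqFun.coeFn_le (f := f.1) (g := g.1)).symm

theorem norm_eq_of_ae {f g : X.carrier} (h : ∀ᵐ x ∂μ, |f.1 x| = |g.1 x|) : ‖f‖ = ‖g‖ :=
  le_antisymm (norm_le_of_ae (h.mono fun _ hx => hx.le))
    (norm_le_of_ae (h.mono fun _ hx => hx.ge))

/-! ### Norm convergence, a.e. convergence and convergence in measure. -/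

/-- The closed half-spaces of the order are norm closed. -/
theorem le_of_tendsto_of_eventually_le {a f : X.carrier} {u : ℕ → X.carrier}
    (hu : Tendsto u atTop (𝓝 f)) (h : ∀ᶠ n in atTop, ∀ᵐ x ∂μ, a.1 x ≤ (u n).1 x) :
    ∀ᵐ x ∂μ, a.1 x ≤ f.1 x := by
  -- The positive part `(a - f)⁺` does not depend on `n` and is eventually dominated by `|u n - f|`,
  -- so its norm is `0`.
  obtain ⟨p, hp⟩ : ∃ p : X.carrier, ⇑p.1 =ᵐ[μ] fun x => max (a.1 x - f.1 x) 0 := by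
    refine exists_coeFn_eq (a - f)
      (((coeFn_measurable a).sub (coeFn_measurable f)).max measurable_const).aestronglyMeasurable ?_
    filter_upwards [coeFn_sub a f] with x hx
    rw [hx, abs_of_nonneg (le_max_right _ _)]
    exact max_le (le_abs_self _) (abs_nonneg _)
  have hle : ∀ᶠ n in atTop, ‖p‖ ≤ ‖u n - f‖ := by
    filter_upwards [h] with n hn
    refine norm_le_of_ae ?_
    filter_upwards [hp, hn, coeFn_sub (u n) f] with x h1 h2 h3
    rw [h1, h3, abs_of_nonneg (le_max_right _ _)]
    exact max_le ((sub_le_sub_right h2 _).trans (le_abs_self _)) (abs_nonneg _)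
  have h0 : ‖p‖ ≤ 0 := ge_of_tendsto (tendsto_iff_norm_sub_tendsto_zero.1 hu) hle
  have hp0 : p = 0 := norm_le_zero_iff.1 h0
  subst hp0
  filter_upwards [hp, coeFn_zero (X := X)] with x h1 h2
  rw [h2] at h1
  have := le_max_left (a.1 x - f.1 x) 0
  linarith

theorem coeFn_sum {ι : Type*} (s : Finset ι) (u : ι → X.carrier) :
    ⇑(∑ i ∈ s, u i).1 =ᵐ[μ] fun x => ∑ i ∈ s, (u i).1 x := by
  classical
  induction s using Finset.induction_on with
  | empty => simpa using coeFn_zero (X := X)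
  | insert i s hi ih =>
    rw [Finset.sum_insert hi]
    filter_upwards [coeFn_add (u i) (∑ i ∈ s, u i), ih] with x h1 h2
    rw [h1, h2, Finset.sum_insert hi]

/-- The partial sums of an absolutely convergent series of nonnegative elements are dominated by an
element of `X`. -/
theorem exists_sum_le {u : ℕ → X.carrier} (hu : Summable fun n => ‖u n‖)
    (h0 : ∀ n, ∀ᵐ x ∂μ, 0 ≤ (u n).1 x) :
    ∃ g : X.carrier, ∀ᵐ x ∂μ, ∀ n, ∑ i ∈ Finset.range n, (u i).1 x ≤ g.1 x := by
  refine ⟨∑' n, u n, ae_all_iff.2 fun n => ?_⟩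
  have := le_of_tendsto_of_eventually_le (a := ∑ i ∈ Finset.range n, u i)
    hu.of_norm.hasSum.tendsto_sum_nat (by
      filter_upwards [eventually_ge_atTop n] with m hm
      filter_upwards [coeFn_sum (Finset.range n) u, coeFn_sum (Finset.range m) u,
        ae_all_iff.2 h0] with x h1 h2 h3
      rw [h1, h2]
      exact Finset.sum_le_sum_of_subset_of_nonneg (Finset.range_mono hm) fun i _ _ => h3 i)
  filter_upwards [this, coeFn_sum (Finset.range n) u] with x h1 h2
  rwa [h2] at h1

/-- A sequence with summable norms converges to `0` almost everywhere. -/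
theorem ae_tendsto_zero_of_summable_norm {u : ℕ → X.carrier} (hu : Summable fun n => ‖u n‖) :
    ∀ᵐ x ∂μ, Tendsto (fun n => (u n).1 x) atTop (𝓝 0) := by
  choose v hv using fun n => exists_abs (u n)
  have hn : ∀ n, ‖v n‖ = ‖u n‖ := fun n => norm_eq_of_ae ((hv n).mono fun x hx => by simp [hx])
  obtain ⟨g, hg⟩ := exists_sum_le (u := v) (by simpa only [hn] using hu) fun n =>
    (hv n).mono fun x hx => hx ▸ abs_nonneg _
  filter_upwards [hg, ae_all_iff.2 hv] with x h1 h2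
  simp only [h2] at h1
  have hs : Summable fun n => |(u n).1 x| :=
    summable_of_sum_range_le (fun _ => abs_nonneg _) h1
  exact (tendsto_zero_iff_abs_tendsto_zero _).2 hs.tendsto_atTop_zero

/-- The norm topology is finer than the topology of local convergence in measure. -/
theorem continuous_id_localMeasureTopology (X : BanachFunctionSpace μ) :
    Continuous[_, X.localMeasureTopology] (id : X.carrier → X.carrier) := by
  suffices key : ∀ (u : ℕ → X.carrier) (f : X.carrier), Tendsto u atTop (𝓝 f) →
      Tendsto (fun n => (u n).1) atTop (@nhds _ (_root_.localMeasureTopology μ) f.1) from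
    (@continuous_induced_rng _ _ _ (_) (_) (_) (_)).2
      (@SeqContinuous.continuous _ _ _ (_) _ _ fun _ _ h => key _ _ h)
  intro u f hu
  -- Every subsequence has a further one whose errors have norm below `2⁻ⁿ`. It converges a.e.,
  -- hence in measure on each set of finite measure.
  refine tendsto_of_subseq_tendsto fun ns hns => ?_
  have hv : Tendsto (fun n => ‖u (ns n) - f‖) atTop (𝓝 0) :=
    tendsto_iff_norm_sub_tendsto_zero.1 (hu.comp hns)
  obtain ⟨ms, -, hms⟩ := extraction_forall_of_eventually'
    (P := fun n k => ‖u (ns k) - f‖ < (1 / 2) ^ n) fun n =>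
      eventually_atTop.1 (hv.eventually_lt_const (by positivity))
  refine ⟨ms, (tendsto_localMeasureTopology_iff _ _ _).2 fun A _ hA' => ?_⟩
  have : IsFiniteMeasure (μ.restrict A) := ⟨by simpa using hA'⟩
  refine tendstoInMeasure_of_tendsto_ae (fun n => AEEqFun.aestronglyMeasurable _ |>.restrict) ?_
  refine ae_restrict_of_ae ?_
  have hs : Summable fun n => ‖u (ns (ms n)) - f‖ :=
    Summable.of_nonneg_of_le (fun _ => _root_.norm_nonneg _) (fun n => (hms n).le)
      summable_geometric_two
  filter_upwards [ae_tendsto_zero_of_summable_norm hs,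
    ae_all_iff.2 fun n => coeFn_sub (u (ns (ms n))) f] with x h1 h2
  simp only [h2] at h1
  exact tendsto_sub_nhds_zero_iff.1 h1

/-! ### Dominated convergence and its consequences. -/

/-- Dominated convergence for an order continuous norm. -/
theorem IsOrderContinuous.tendsto_zero (hoc : X.IsOrderContinuous) {f : ℕ → X.carrier}
    (g : X.carrier) (hg : ∀ n, ∀ᵐ x ∂μ, |(f n).1 x| ≤ |g.1 x|)
    (h0 : ∀ᵐ x ∂μ, Tendsto (fun n => (f n).1 x) atTop (𝓝 0)) : Tendsto f atTop (𝓝 0) := by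
  have hg' := ae_all_iff.2 hg
  -- The tail suprema stay below `|g|`, hence lie in `X`, and decrease to `0`; order continuity
  -- applies to them, and they dominate `|f n|`.
  have hex : ∀ n, ∃ k : X.carrier, ⇑k.1 =ᵐ[μ] fun x => ⨆ i, |(f (n + i)).1 x| := fun n => by
    refine exists_coeFn_eq g
      (Measurable.iSup fun i => (coeFn_measurable (f (n + i))).norm).aestronglyMeasurable ?_
    filter_upwards [hg'] with x hx
    rw [abs_of_nonneg (Real.iSup_nonneg fun _ => abs_nonneg _)]
    exact ciSup_le fun i => hx _
  choose h hh using hex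
  have hh' := ae_all_iff.2 hh
  have hbdd : ∀ᵐ x ∂μ, ∀ n, BddAbove (range fun i => |(f (n + i)).1 x|) := by
    filter_upwards [hg'] with x hx n
    exact ⟨|g.1 x|, by rintro _ ⟨i, rfl⟩; exact hx _⟩
  have hanti : ∀ m n, m ≤ n → h n ≤ h m := fun m n hmn => le_iff_ae.2 <| by
    filter_upwards [hh', hbdd] with x hx hb
    rw [hx, hx]
    refine ciSup_le fun i => ?_
    refine (le_ciSup (hb m) (n - m + i)).trans' ?_
    rw [show m + (n - m + i) = n + i by omega]
  have hlub : IsGLB (range h) 0 := by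
    constructor
    · rintro _ ⟨n, rfl⟩
      refine le_iff_ae.2 ?_
      filter_upwards [hh', coeFn_zero (X := X)] with x hx hx0
      rw [hx, hx0]
      exact Real.iSup_nonneg fun _ => abs_nonneg _
    · intro b hb
      have hb' : ∀ᵐ x ∂μ, ∀ n, b.1 x ≤ (h n).1 x :=
        ae_all_iff.2 fun n => le_iff_ae.1 (hb ⟨n, rfl⟩)
      refine le_iff_ae.2 ?_
      filter_upwards [hh', hb', h0, coeFn_zero (X := X)] with x hx hbx hx0 hz
      rw [hz]
      refine le_of_forall_pos_le_add fun ε hε => ?_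
      obtain ⟨N, hN⟩ := Metric.tendsto_atTop.1 hx0 ε hε
      refine (hbx N).trans ?_
      rw [hx, zero_add]
      exact ciSup_le fun i => by simpa using (hN (N + i) (by omega)).le
  have hdir : DirectedOn (· ≥ ·) (range h) := by
    rintro _ ⟨m, rfl⟩ _ ⟨n, rfl⟩
    exact ⟨h (max m n), ⟨_, rfl⟩, hanti _ _ (le_max_left _ _), hanti _ _ (le_max_right _ _)⟩
  have ht := hoc (range h) (range_nonempty h) hdir hlub
  rw [tendsto_zero_iff_norm_tendsto_zero, Metric.tendsto_atTop]
  intro ε hε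
  have : Nonempty (range h) := (range_nonempty h).to_subtype
  have : IsDirected (range h) (· ≥ ·) := ⟨fun a b => by
    obtain ⟨c, hc, h1, h2⟩ := hdir a.1 a.2 b.1 b.2
    exact ⟨⟨c, hc⟩, h1, h2⟩⟩
  obtain ⟨⟨_, N, rfl⟩, hd⟩ := eventually_atBot.1 (ht.eventually_lt_const hε)
  refine ⟨N, fun n hn => ?_⟩
  have h1 : ‖f n‖ ≤ ‖h n‖ := norm_le_of_ae <| by
    filter_upwards [hh', hbdd] with x hx hb
    rw [hx]
    exact (le_ciSup (hb n) 0).trans (le_abs_self _)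
  have h2 := hd ⟨h n, n, rfl⟩ (hanti _ _ hn)
  simpa using h1.trans_lt h2

/-- The restriction `χ_B f`. -/
noncomputable def indicator (f : X.carrier) {B : Set Ω} (hB : MeasurableSet B) : X.carrier :=
  (exists_indicator f hB).choose

theorem coeFn_indicator (f : X.carrier) {B : Set Ω} (hB : MeasurableSet B) :
    ⇑(indicator f hB).1 =ᵐ[μ] B.indicator f.1 :=
  (exists_indicator f hB).choose_spec

theorem norm_indicator_mono (f : X.carrier) {B C : Set Ω} (hB : MeasurableSet B)
    (hC : MeasurableSet C) (h : B ⊆ C) : ‖indicator f hB‖ ≤ ‖indicator f hC‖ := by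
  refine norm_le_of_ae ?_
  filter_upwards [coeFn_indicator f hB, coeFn_indicator f hC] with x h1 h2
  rw [h1, h2]
  exact norm_indicator_le_of_subset h (⇑f.1) x

/-- Absolute continuity of an order continuous norm with respect to `μ`. -/
theorem IsOrderContinuous.exists_norm_indicator_lt (hoc : X.IsOrderContinuous) (e : X.carrier)
    {ε : ℝ} (hε : 0 < ε) : ∃ δ : ℝ≥0∞, 0 < δ ∧ ∀ (C : Set Ω) (hC : MeasurableSet C), μ C < δ →
      ‖indicator e hC‖ < ε := by
  by_contra! hcon
  -- Borel–Cantelli: with `μ (C n) < 2⁻ⁿ`, almost every point lies in finitely many `C n`, so `χ_{C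
  -- n} e → 0` a.e. under the bound `|e|`.
  choose C hC hCμ hCe using fun n : ℕ => hcon ((2⁻¹ : ℝ≥0∞) ^ n) (ENNReal.pow_pos (by simp) n)
  have hsum : ∑' n, μ (C n) ≠ ∞ :=
    ((ENNReal.tsum_le_tsum fun n => (hCμ n).le).trans_lt (by
      rw [ENNReal.tsum_geometric, ENNReal.one_sub_inv_two, inv_inv]
      exact ENNReal.ofNat_lt_top)).ne
  have h0 := ae_eventually_notMem hsum
  have ht : Tendsto (fun n => indicator e (hC n)) atTop (𝓝 0) := by
    refine hoc.tendsto_zero e (fun n => (coeFn_indicator e (hC n)).mono fun x hx => ?_) ?_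
    · rw [hx]
      exact norm_indicator_le_norm_self (⇑e.1) x
    · filter_upwards [h0, ae_all_iff.2 fun n => coeFn_indicator e (hC n)] with x hx h
      refine tendsto_const_nhds.congr' ?_
      filter_upwards [hx] with n hn
      rw [h, indicator_of_notMem hn]
  obtain ⟨n, hn⟩ := ((tendsto_zero_iff_norm_tendsto_zero.1 ht).eventually_lt_const hε).exists
  exact (hCe n).not_gt hn

/-- `B ↦ χ_B e` is continuous for the measure distance. -/
theorem IsOrderContinuous.continuous_indicator (hoc : X.IsOrderContinuous) (e : X.carrier) :
    Continuous fun B : MeasuredSets μ => indicator e B.2 := by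
  rw [EMetric.continuous_iff']
  intro B ε hε
  obtain ⟨r, hr, hrε⟩ : ∃ r : ℝ, 0 < r ∧ ENNReal.ofReal r ≤ ε := by
    rcases eq_or_ne ε ∞ with rfl | hε'
    · exact ⟨1, one_pos, le_top⟩
    · exact ⟨ε.toReal, ENNReal.toReal_pos hε.ne' hε', (ENNReal.ofReal_toReal hε').le⟩
  obtain ⟨δ, hδ, h⟩ := hoc.exists_norm_indicator_lt e hr
  filter_upwards [Metric.eball_mem_nhds B hδ] with C hC
  rw [edist_dist, dist_eq_norm]
  refine lt_of_lt_of_le ((ENNReal.ofReal_lt_ofReal_iff hr).2 ?_) hrε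
  refine (norm_le_of_ae ?_).trans_lt (h _ (C.2.symmDiff B.2) hC)
  filter_upwards [coeFn_sub (indicator e C.2) (indicator e B.2), coeFn_indicator e C.2,
    coeFn_indicator e B.2, coeFn_indicator e (C.2.symmDiff B.2)] with x h1 h2 h3 h4
  rw [h1, h2, h3, h4]
  by_cases hxB : x ∈ B.1 <;> by_cases hxC : x ∈ C.1 <;>
    simp [Set.indicator, mem_symmDiff, hxB, hxC]

/-- `χ_{A n} f → f` when `A` increases to the whole space. -/
theorem IsOrderContinuous.tendsto_indicator (hoc : X.IsOrderContinuous) (f : X.carrier)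
    {A : ℕ → Set Ω} (hA : ∀ n, MeasurableSet (A n)) (hmono : Monotone A)
    (hU : ⋃ n, A n = univ) : Tendsto (fun n => indicator f (hA n)) atTop (𝓝 f) := by
  rw [← tendsto_sub_nhds_zero_iff]
  have key : ∀ᵐ x ∂μ, ∀ n, (indicator f (hA n) - f).1 x = (A n).indicator f.1 x - f.1 x := by
    filter_upwards [ae_all_iff.2 fun n => coeFn_indicator f (hA n),
      ae_all_iff.2 fun n => coeFn_sub (indicator f (hA n)) f] with x h1 h2 n
    rw [h2, h1]
  refine hoc.tendsto_zero f (fun n => key.mono fun x hx => ?_) (key.mono fun x hx => ?_)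
  · rw [hx]
    by_cases h : x ∈ A n <;> simp [h]
  · obtain ⟨N, hN⟩ := mem_iUnion.1 (hU ▸ mem_univ x)
    refine tendsto_const_nhds.congr' ?_
    filter_upwards [eventually_ge_atTop N] with n hn
    rw [hx, indicator_of_mem (hmono hn hN), sub_self]

/-- The restrictions of a strictly positive function are total in an order continuous space. -/
theorem IsOrderContinuous.mem_closure_span_indicator (hoc : X.IsOrderContinuous) {e : X.carrier}
    (he : X.IsStrictlyPositive e) (f : X.carrier) :
    f ∈ closure (Submodule.span ℝ (range fun B : MeasuredSets μ => indicator e B.2) :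
      Set X.carrier) := by
  let q : Ω → ℝ := fun x => f.1 x / e.1 x
  have hq : Measurable q := (coeFn_measurable f).div (coeFn_measurable e)
  have hs : ∀ s : SimpleFunc Ω ℝ, ∃ k ∈ Submodule.span ℝ
      (range fun B : MeasuredSets μ => indicator e B.2), ⇑k.1 =ᵐ[μ] fun x => e.1 x * s x := by
    intro s
    induction s using SimpleFunc.induction with
    | const c hB =>
      rename_i B
      refine ⟨c • indicator e hB, Submodule.smul_mem _ _ (Submodule.subset_span ⟨⟨B, hB⟩, rfl⟩), ?_⟩
      filter_upwards [coeFn_smul c (indicator e hB), coeFn_indicator e hB] with x h1 h2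
      rw [h1, h2]
      by_cases hx : x ∈ B <;> simp [hx, mul_comm]
    | add _ hs ht =>
      obtain ⟨k, hk, hk'⟩ := hs
      obtain ⟨l, hl, hl'⟩ := ht
      refine ⟨k + l, add_mem hk hl, ?_⟩
      filter_upwards [hk', hl', coeFn_add k l] with x h1 h2 h3
      rw [h3, h1, h2, SimpleFunc.coe_add, Pi.add_apply, mul_add]
  let s : ℕ → SimpleFunc Ω ℝ := SimpleFunc.approxOn q hq univ 0 (mem_univ _)
  choose k hk hks using fun n => hs (s n)
  have key : ∀ᵐ x ∂μ, ∀ n, (k n - f).1 x = e.1 x * (s n x - q x) := by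
    filter_upwards [he, ae_all_iff.2 hks, ae_all_iff.2 fun n => coeFn_sub (k n) f] with x h0 h1 h2 n
    rw [h2, h1, mul_sub, mul_div_cancel₀ _ h0.ne']
  refine mem_closure_of_tendsto (f := k) (b := atTop) ?_ (.of_forall hk)
  rw [← tendsto_sub_nhds_zero_iff]
  refine hoc.tendsto_zero f (fun n => ?_) ?_
  · filter_upwards [key, he] with x hx h0
    -- Approximating from the base point `0` never does worse than `0` itself. This makes `f` a
    -- dominating function for `e * s n - f`.
    have h1 : |s n x - q x| ≤ |q x| := by
      have := SimpleFunc.edist_approxOn_le hq (mem_univ (0 : ℝ)) x n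
      rw [edist_dist, edist_dist, ENNReal.ofReal_le_ofReal_iff dist_nonneg] at this
      simpa [Real.dist_eq] using this
    rw [hx, abs_mul]
    calc |e.1 x| * |s n x - q x| ≤ |e.1 x| * |q x| := by gcongr
      _ = |f.1 x| := by rw [← abs_mul, mul_div_cancel₀ _ h0.ne']
  · filter_upwards [key] with x hx
    simp only [hx]
    have h1 : Tendsto (fun n => s n x) atTop (𝓝 (q x)) :=
      SimpleFunc.tendsto_approxOn hq (mem_univ (0 : ℝ)) (by simp)
    simpa using (tendsto_sub_nhds_zero_iff.2 h1).const_mul (e.1 x)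

/-- The closed span of a separable set is separable, and here it is all of `X`. -/
theorem IsOrderContinuous.separableSpace_of_indicator (hoc : X.IsOrderContinuous) {e : X.carrier}
    (he : X.IsStrictlyPositive e) (h : TopologicalSpace.IsSeparable
      (range fun B : MeasuredSets μ => indicator e B.2)) :
    TopologicalSpace.SeparableSpace X.carrier :=
  TopologicalSpace.isSeparable_univ_iff.1 <| (h.span (R := ℝ)).closure.mono fun f _ =>
    hoc.mem_closure_span_indicator he f

theorem indicator_mem_components {e : X.carrier} (he : X.IsStrictlyPositive e) {B : Set Ω}
    (hB : MeasurableSet B) : indicator e hB ∈ X.components e := by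
  refine ⟨le_iff_ae.2 ?_, le_iff_ae.2 ?_, AEEqFun.ext ?_⟩
  · filter_upwards [coeFn_indicator e hB, coeFn_zero (X := X), he] with x h1 h2 h3
    rw [h1, h2]
    exact indicator_apply_nonneg fun _ => h3.le
  · filter_upwards [coeFn_indicator e hB, he] with x h1 h3
    rw [h1]
    exact indicator_apply_le' (fun _ => le_rfl) fun _ => h3.le
  · filter_upwards [coeFn_indicator e hB, AEEqFun.coeFn_inf |(indicator e hB).1|
      |e.1 - (indicator e hB).1|, AEEqFun.coeFn_abs (indicator e hB).1,
      AEEqFun.coeFn_abs (e.1 - (indicator e hB).1), AEEqFun.coeFn_sub e.1 (indicator e hB).1,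
      AEEqFun.coeFn_zero (μ := μ) (β := ℝ)] with x h1 h2 h3 h4 h5 h6
    rw [h2, h3, h4, h5, h6, Pi.sub_apply, h1]
    by_cases hx : x ∈ B <;> simp [hx]

/-! ### Supports and strictly positive elements. -/

/-- In an order continuous space over a semi-finite measure every element vanishes outside a
countable union of sets of finite measure. -/
theorem IsOrderContinuous.exists_finite_cover_support (hoc : X.IsOrderContinuous)
    (hμ : IsSemifiniteMeasure μ) (f : X.carrier) : ∃ C : ℕ → Set Ω, (∀ n, μ (C n) < ∞) ∧
      ∀ᵐ x ∂μ, f.1 x ≠ 0 → x ∈ ⋃ n, C n := by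
  obtain ⟨a, ha⟩ := exists_abs f
  -- The restrictions of `|f|` to complements of sets of finite measure form a directed family, in
  -- general not a sequence: order continuity for nets is needed.
  let D : Set X.carrier :=
    {k | ∃ (C : Set Ω) (hC : MeasurableSet C), μ C < ∞ ∧ k = indicator a hC.compl}
  have hDn : D.Nonempty := ⟨_, ∅, .empty, by simp, rfl⟩
  have hanti : ∀ (B C : Set Ω) (hB : MeasurableSet B) (hC : MeasurableSet C), B ⊆ C →
      indicator a hC.compl ≤ indicator a hB.compl := fun B C hB hC h => le_iff_ae.2 <| by
    filter_upwards [coeFn_indicator a hB.compl, coeFn_indicator a hC.compl, ha] with x h1 h2 h3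
    rw [h1, h2]
    exact indicator_apply_le' (fun hx => by rw [indicator_of_mem (compl_subset_compl.2 h hx)])
      fun _ => indicator_apply_nonneg fun _ => h3 ▸ abs_nonneg _
  have hdir : DirectedOn (· ≥ ·) D := by
    rintro _ ⟨B, hB, hB', rfl⟩ _ ⟨C, hC, hC', rfl⟩
    exact ⟨_, ⟨B ∪ C, hB.union hC, measure_union_lt_top hB' hC', rfl⟩,
      hanti _ _ hB (hB.union hC) subset_union_left,
      hanti _ _ hC (hB.union hC) subset_union_right⟩
  have hglb : IsGLB D 0 := by
    constructor
    · rintro _ ⟨B, hB, hB', rfl⟩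
      refine le_iff_ae.2 ?_
      filter_upwards [coeFn_indicator a hB.compl, coeFn_zero (X := X), ha] with x h1 h2 h3
      rw [h1, h2]
      exact indicator_apply_nonneg fun _ => h3 ▸ abs_nonneg _
    · intro b hb
      have hP : MeasurableSet {x | 0 < b.1 x} :=
        measurableSet_lt measurable_const (coeFn_measurable b)
      -- Otherwise semi-finiteness yields `C` of finite positive measure on which the lower bound
      -- `b` is positive, although `b ≤ χ_{Cᶜ} |f|` vanishes there.
      have hP0 : μ {x | 0 < b.1 x} = 0 := by
        by_contra hne
        obtain ⟨C, hCP, hC, hC0, hCt⟩ : ∃ C ⊆ {x | 0 < b.1 x}, MeasurableSet C ∧ 0 < μ C ∧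
            μ C < ∞ := by
          rcases eq_or_ne (μ {x | 0 < b.1 x}) ∞ with h | h
          · exact hμ _ hP h
          · exact ⟨_, subset_rfl, hP, pos_iff_ne_zero.2 hne, h.lt_top⟩
        refine hC0.ne' (measure_mono_null (fun x hx => ?_) (ae_iff.1
          ((le_iff_ae.1 (hb ⟨C, hC, hCt, rfl⟩)).and (coeFn_indicator a hC.compl))))
        rintro ⟨h1, h2⟩
        rw [h2, indicator_of_notMem (by simpa using hx)] at h1
        exact h1.not_gt (hCP hx)
      refine le_iff_ae.2 ?_
      filter_upwards [measure_eq_zero_iff_ae_notMem.1 hP0, coeFn_zero (X := X)] with x h1 h2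
      rw [h2]
      exact not_lt.1 h1
  have ht := hoc D hDn hdir hglb
  have : Nonempty D := hDn.to_subtype
  have : IsDirected D (· ≥ ·) := ⟨fun a b => by
    obtain ⟨c, hc, h1, h2⟩ := hdir a.1 a.2 b.1 b.2
    exact ⟨⟨c, hc⟩, h1, h2⟩⟩
  have hex : ∀ n : ℕ, ∃ (C : Set Ω) (hC : MeasurableSet C), μ C < ∞ ∧
      ‖indicator a hC.compl‖ < 1 / ((n : ℝ) + 1) := fun n => by
    obtain ⟨⟨_, C, hC, hC', rfl⟩, h⟩ :=
      (ht.eventually_lt_const (u := 1 / ((n : ℝ) + 1)) (by positivity)).exists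
    exact ⟨C, hC, hC', h⟩
  choose C hC hC' hCn using hex
  refine ⟨C, hC', ?_⟩
  have hU := (MeasurableSet.iUnion hC).compl
  have h0 : indicator a hU = 0 := by
    refine norm_le_zero_iff.1 (ge_of_tendsto' tendsto_one_div_add_atTop_nhds_zero_nat fun n => ?_)
    exact (norm_indicator_mono a hU (hC n).compl
      (compl_subset_compl.2 (subset_iUnion C n))).trans (hCn n).le
  filter_upwards [coeFn_indicator a hU, coeFn_zero (X := X), ha] with x h1 h2 h3 hx
  by_contra hxC
  rw [h0, h2, indicator_of_mem hxC, h3] at h1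
  exact hx (abs_eq_zero.1 h1.symm)

theorem aeEqFun_pos_of {g : Ω →ₘ[μ] ℝ} (h : 0 < g) :
    (∀ᵐ x ∂μ, 0 ≤ g x) ∧ μ {x | 0 < g x} ≠ 0 := by
  have h0 : ∀ᵐ x ∂μ, 0 ≤ g x := by
    filter_upwards [AEEqFun.coeFn_le.2 h.le, AEEqFun.coeFn_zero (μ := μ) (β := ℝ)] with x h1 h2
    rwa [h2] at h1
  refine ⟨h0, fun hz => h.ne' (AEEqFun.ext ?_)⟩
  filter_upwards [measure_eq_zero_iff_ae_notMem.1 hz, h0,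
    AEEqFun.coeFn_zero (μ := μ) (β := ℝ)] with x h1 h2 h3
  rw [h3]
  exact le_antisymm (not_lt.1 h1) h2

/-- In an order dense space every nonnull set supports a nonzero positive element bounded by `1`. -/
theorem IsOrderDense.exists_le_indicator (hod : X.IsOrderDense) {B : Set Ω} (hB : MeasurableSet B)
    (hB0 : μ B ≠ 0) : ∃ f : X.carrier, (∀ᵐ x ∂μ, 0 ≤ f.1 x) ∧ μ {x | 0 < f.1 x} ≠ 0 ∧
      ∀ᵐ x ∂μ, x ∉ B → f.1 x = 0 := by
  have hm : AEStronglyMeasurable (B.indicator fun _ => (1 : ℝ)) μ :=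
    (measurable_const.indicator hB).aestronglyMeasurable
  have hpos : 0 < AEEqFun.mk _ hm := by
    refine lt_of_le_of_ne (AEEqFun.coeFn_le.1 ?_) fun h => hB0 ?_
    · filter_upwards [AEEqFun.coeFn_mk _ hm, AEEqFun.coeFn_zero (μ := μ) (β := ℝ)] with x h1 h2
      rw [h1, h2]
      exact indicator_apply_nonneg fun _ => zero_le_one
    · refine measure_eq_zero_iff_ae_notMem.2 ?_
      filter_upwards [AEEqFun.coeFn_mk _ hm, AEEqFun.coeFn_zero (μ := μ) (β := ℝ)] with x h1 h2 hx
      rw [← h, h2, indicator_of_mem hx] at h1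
      exact zero_ne_one h1
  obtain ⟨f, hf, hf0, hfle⟩ := hod _ hpos
  obtain ⟨h0, h1⟩ := aeEqFun_pos_of hf0
  refine ⟨⟨f, hf⟩, h0, h1, ?_⟩
  filter_upwards [h0, AEEqFun.coeFn_le.2 hfle, AEEqFun.coeFn_mk _ hm] with x h2 h3 h4 hx
  rw [h4, indicator_of_notMem hx] at h3
  exact le_antisymm h3 h2

/-- Countably many elements vanish, up to null sets, where a single one does. -/
theorem exists_support_subset (u : ℕ → X.carrier) : ∃ g : X.carrier, (∀ᵐ x ∂μ, 0 ≤ g.1 x) ∧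
    ∀ᵐ x ∂μ, ∀ n, (u n).1 x ≠ 0 → 0 < g.1 x := by
  choose v hv using fun n => exists_abs (u n)
  -- These weights make `∑ c n • v n` absolutely convergent; the `1 +` covers `v n = 0`.
  let c : ℕ → ℝ := fun n => (1 / 2) ^ n / (1 + ‖v n‖)
  have hc : ∀ n, 0 < c n := fun n => by positivity
  have hle : ∀ n, ‖c n • v n‖ ≤ (1 / 2) ^ n := fun n => by
    rw [_root_.norm_smul, Real.norm_of_nonneg (hc n).le, div_mul_eq_mul_div, div_le_iff₀ (by positivity)]
    gcongr
    linarith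
  have hval : ∀ᵐ x ∂μ, ∀ n, (c n • v n).1 x = c n * |(u n).1 x| := by
    filter_upwards [ae_all_iff.2 hv, ae_all_iff.2 fun n => coeFn_smul (c n) (v n)] with x h1 h2 n
    rw [h2, h1]
  obtain ⟨g, hg⟩ := exists_sum_le (u := fun n => c n • v n)
    (Summable.of_nonneg_of_le (fun _ => _root_.norm_nonneg _) hle summable_geometric_two)
    fun n => hval.mono fun x hx => by rw [hx]; have := hc n; positivity
  refine ⟨g, hg.mono fun x hx => by simpa using hx 0, ?_⟩
  filter_upwards [hg, hval] with x h1 h2 n hn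
  have h3 := h1 (n + 1)
  simp only [h2] at h3
  refine lt_of_lt_of_le ?_ h3
  refine Finset.sum_pos' (fun i _ => by have := hc i; positivity) ⟨n, by simp, ?_⟩
  have := hc n
  positivity

/-- Over a `σ`-finite measure an order dense space contains a strictly positive element. -/
theorem IsOrderDense.exists_isStrictlyPositive [SigmaFinite μ] (hod : X.IsOrderDense) :
    ∃ e : X.carrier, X.IsStrictlyPositive e := by
  obtain ⟨ν, _, hμν, hνμ⟩ := exists_isFiniteMeasure_absolutelyContinuous μ
  -- Exhaustion: a maximizing sequence of supports is absorbed by a single `g`. If `g` vanished on a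
  -- nonnull set, order density would enlarge its support beyond the supremum, which is finite
  -- because `ν` is.
  let S : Set ℝ≥0∞ := range fun f : X.carrier => ν {x | f.1 x ≠ 0}
  obtain ⟨u, -, hu, huS⟩ := exists_seq_tendsto_sSup (S := S) ⟨_, 0, rfl⟩ (OrderTop.bddAbove _)
  choose w hw using huS
  obtain ⟨g, hg0, hg⟩ := exists_support_subset w
  have hmax : sSup S ≤ ν {x | 0 < g.1 x} := by
    refine le_of_tendsto' hu fun n => ?_
    rw [← hw n]
    exact measure_mono_ae (Eventually.mono (hνμ.ae_le hg) fun x hx => hx n)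
  refine ⟨g, ?_⟩
  have hgm : MeasurableSet {x | g.1 x ≤ 0} :=
    measurableSet_le (coeFn_measurable g) measurable_const
  suffices h : μ {x | g.1 x ≤ 0} = 0 by
    filter_upwards [measure_eq_zero_iff_ae_notMem.1 h] with x hx using not_le.1 hx
  by_contra hne
  obtain ⟨f, hf0, hf1, hf2⟩ := hod.exists_le_indicator hgm hne
  have hfm : MeasurableSet {x | 0 < f.1 x} :=
    measurableSet_lt measurable_const (coeFn_measurable f)
  have h1 : ν ({x | 0 < g.1 x} ∪ {x | 0 < f.1 x}) ≤ sSup S := by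
    refine le_trans (measure_mono_ae ((hνμ.ae_le ?_))) (le_sSup ⟨g + f, rfl⟩)
    filter_upwards [hg0, hf0, coeFn_add g f] with x h1 h2 h3 hx
    have : 0 < g.1 x + f.1 x := by
      rcases hx with hx | hx
      · exact add_pos_of_pos_of_nonneg hx h2
      · exact add_pos_of_nonneg_of_pos h1 hx
    exact fun h => this.ne' (h3 ▸ h)
  have hdisj : AEDisjoint ν {x | 0 < g.1 x} {x | 0 < f.1 x} := by
    refine measure_eq_zero_iff_ae_notMem.2 (hνμ.ae_le ?_)
    filter_upwards [hf2] with x h1 h2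
    exact h2.2.ne' (h1 (not_le.2 h2.1))
  rw [measure_union₀ hfm.nullMeasurableSet hdisj] at h1
  have h2 := h1.trans hmax
  have h3 : ν {x | 0 < f.1 x} ≤ 0 := by
    refine (ENNReal.add_le_add_iff_left (measure_ne_top ν {x | 0 < g.1 x})).1 (by simpa using h2)
  exact hf1 (hμν (le_antisymm h3 zero_le))

/-! ### Consequences of separability in measure. -/

/-- A sequence that is dense for local convergence in measure. -/
theorem exists_seq_measure_lt (hX : @TopologicalSpace.SeparableSpace X.carrier
    X.localMeasureTopology) : ∃ d : ℕ → X.carrier, ∀ (f : X.carrier) (A : Set Ω),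
      MeasurableSet A → μ A < ∞ → ∀ ε : ℝ, 0 < ε →
        ∃ n, μ {x ∈ A | ε ≤ |(d n).1 x - f.1 x|} < ENNReal.ofReal ε := by
  obtain ⟨d, hd⟩ := @TopologicalSpace.exists_dense_seq X.carrier X.localMeasureTopology hX _
  refine ⟨d, fun f A hA hA' ε hε => ?_⟩
  -- Applied to the identity along the neighbourhood filter, the convergence criterion shows that
  -- the basic sets are neighbourhoods of `f`.
  have h1 := tendstoInMeasure_iff_norm.1 ((tendsto_localMeasureTopology_iff
    (@nhds _ (_root_.localMeasureTopology μ) f.1) id f.1).1 tendsto_id A hA hA') ε hε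
  have h2 := h1.eventually_lt_const (ENNReal.ofReal_pos.2 hε)
  have h3 := (@nhds_induced _ _ (_root_.localMeasureTopology μ) Subtype.val f) ▸
    preimage_mem_comap (m := (Subtype.val : X.carrier → _)) h2
  obtain ⟨_, hn, n, rfl⟩ := (@mem_closure_iff_nhds _ X.localMeasureTopology _ _).1 (hd f) _ h3
  refine ⟨n, lt_of_eq_of_lt ?_ hn⟩
  rw [Measure.restrict_apply' hA, inter_comm]
  rfl

/-- One `g` is positive wherever some member of the dense sequence is nonzero, and its support is
covered by countably many sets of finite measure. Off that support all `d n` vanish, so they cannot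
approximate a nonzero element living there; by order density the zero set of `g` is null. -/
theorem IsOrderContinuous.sigmaFinite (hoc : X.IsOrderContinuous) (hμ : IsSemifiniteMeasure μ)
    (hod : X.IsOrderDense) (hX : @TopologicalSpace.SeparableSpace X.carrier
      X.localMeasureTopology) : SigmaFinite μ := by
  obtain ⟨d, hd⟩ := exists_seq_measure_lt hX
  obtain ⟨g, hg0, hg⟩ := exists_support_subset d
  obtain ⟨C, hC, hgC⟩ := hoc.exists_finite_cover_support hμ g
  have hPm : MeasurableSet {x | g.1 x = 0} := coeFn_measurable g (measurableSet_singleton 0)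
  have hP : μ {x | g.1 x = 0} = 0 := by
    by_contra hne
    obtain ⟨A, hAP, hA, hA0, hA'⟩ : ∃ A ⊆ {x | g.1 x = 0}, MeasurableSet A ∧ 0 < μ A ∧
        μ A < ∞ := by
      rcases eq_or_ne (μ {x | g.1 x = 0}) ∞ with h | h
      · exact hμ _ hPm h
      · exact ⟨_, subset_rfl, hPm, pos_iff_ne_zero.2 hne, h.lt_top⟩
    obtain ⟨f, hf0, hf1, hf2⟩ := hod.exists_le_indicator hA hA0.ne'
    refine hf1 (measure_eq_zero_iff_ae_notMem.2 ?_)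
    have key : ∀ k : ℕ, μ {x | 1 / ((k : ℝ) + 1) ≤ f.1 x} = 0 := fun k => by
      have hk : 0 < 1 / ((k : ℝ) + 1) := by positivity
      refine le_antisymm (ENNReal.le_of_forall_pos_le_add fun ε hε _ => ?_) zero_le
      -- One parameter is both threshold and measure bound: being at most `1 / (k + 1)` it captures
      -- the level set, being at most `ε` it makes that set small.
      have hm : 0 < min (1 / ((k : ℝ) + 1)) ε := lt_min hk hε
      obtain ⟨n, hn⟩ := hd f A hA hA' _ hm
      rw [zero_add]
      refine (le_trans (measure_mono_ae ?_) hn.le).trans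
        ((ENNReal.ofReal_le_ofReal (min_le_right _ _)).trans (by simp))
      filter_upwards [hf2, hg] with x h1 h2 (h3 : _ ≤ f.1 x)
      have hxA : x ∈ A := by
        by_contra hx
        rw [h1 hx] at h3
        exact h3.not_gt hk
      have hd0 : (d n).1 x = 0 := by
        by_contra hx
        exact (h2 n hx).ne' (hAP hxA)
      refine ⟨hxA, ?_⟩
      rw [hd0, zero_sub, abs_neg]
      exact (min_le_left _ _).trans (h3.trans (le_abs_self _))
    filter_upwards [ae_all_iff.2 fun k => measure_eq_zero_iff_ae_notMem.1 (key k)] with x hx h0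
    obtain ⟨k, hk⟩ := exists_nat_one_div_lt h0
    exact hx k hk.le
  have hN : μ (⋃ n, C n)ᶜ = 0 := by
    refine measure_eq_zero_iff_ae_notMem.2 ?_
    filter_upwards [hgC, measure_eq_zero_iff_ae_notMem.1 hP] with x h1 h2 h3
    exact h3 (h1 h2)
  refine Measure.sigmaFinite_of_countable (S := insert (⋃ n, C n)ᶜ (range C))
    ((countable_range C).insert _) ?_ ?_
  · rintro s (rfl | ⟨n, rfl⟩)
    · rw [hN]
      exact ENNReal.zero_lt_top
    · exact hC n
  · rw [sUnion_insert, sUnion_range, compl_union_self]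

/-- Cutting at `e / 2` separates the values `e` and `0` of `χ_B e`: at a misclassified point `d n`
is off by at least `e / 2`. Where `e ≥ 2 / (k + 1)` the error is thus at least `1 / (k + 1)`, which
happens on a small set only; the rest of `A`, where `e` is small, has measure tending to `0` in `k`.
-/
theorem separableSpace_measuredSets_of_localMeasureTopology
    (hX : @TopologicalSpace.SeparableSpace X.carrier X.localMeasureTopology) {e : X.carrier}
    (he : X.IsStrictlyPositive e) {A : Set Ω} (hA : MeasurableSet A) (hA' : μ A < ∞) :
    TopologicalSpace.SeparableSpace {B : MeasuredSets μ // (B : Set Ω) ⊆ A} := by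
  obtain ⟨d, hd⟩ := exists_seq_measure_lt hX
  have hm : ∀ n, MeasurableSet (A ∩ {x | e.1 x / 2 < (d n).1 x}) := fun n =>
    hA.inter (measurableSet_lt ((coeFn_measurable e).div_const 2) (coeFn_measurable (d n)))
  let s : ℕ → {B : MeasuredSets μ // (B : Set Ω) ⊆ A} := fun n =>
    ⟨⟨_, hm n⟩, inter_subset_left⟩
  refine ⟨range s, countable_range s, fun B => EMetric.mem_closure_iff.2 fun ε hε => ?_⟩
  have hsmall : Tendsto (fun k : ℕ => μ (A ∩ {x | e.1 x < 2 * (1 / ((k : ℝ) + 1))})) atTop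
      (𝓝 0) := by
    have hI : μ (⋂ k : ℕ, A ∩ {x | e.1 x < 2 * (1 / ((k : ℝ) + 1))}) = 0 := by
      refine measure_eq_zero_iff_ae_notMem.2 ?_
      filter_upwards [he] with x hx h
      obtain ⟨k, hk⟩ := exists_nat_one_div_lt (half_pos hx)
      have := (mem_iInter.1 h k).2
      simp only [mem_ofPred_eq] at this
      linarith
    rw [← hI]
    refine tendsto_measure_iInter_atTop (fun k => (hA.inter
      (measurableSet_lt (coeFn_measurable e) measurable_const)).nullMeasurableSet) ?_
      ⟨0, ((measure_mono inter_subset_left).trans_lt hA').ne⟩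
    intro k l hkl x hx
    have hlk : 2 * (1 / ((l : ℝ) + 1)) ≤ 2 * (1 / ((k : ℝ) + 1)) := by gcongr
    exact ⟨hx.1, lt_of_lt_of_le hx.2 hlk⟩
  have hof : Tendsto (fun k : ℕ => ENNReal.ofReal (1 / ((k : ℝ) + 1))) atTop (𝓝 0) := by
    simpa using ENNReal.tendsto_ofReal tendsto_one_div_add_atTop_nhds_zero_nat
  obtain ⟨k, hk⟩ := ((hsmall.add hof).eventually_lt_const (by simpa using hε)).exists
  have hk0 : 0 < 1 / ((k : ℝ) + 1) := by positivity
  obtain ⟨n, hn⟩ := hd (indicator e B.1.2) A hA hA' _ hk0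
  refine ⟨s n, ⟨n, rfl⟩, lt_of_le_of_lt ?_ hk⟩
  refine le_trans ?_ (add_le_add_right hn.le _)
  refine le_trans (measure_mono_ae ?_) (measure_union_le _ _)
  filter_upwards [coeFn_indicator e B.1.2] with x hx hxs
  have hxs' : x ∈ symmDiff B.1.1 (A ∩ {x | e.1 x / 2 < (d n).1 x}) := hxs
  have hBA : x ∈ B.1.1 → x ∈ A := fun h => B.2 h
  by_cases hsm : e.1 x < 2 * (1 / ((k : ℝ) + 1))
  · left
    refine ⟨?_, hsm⟩
    rcases hxs' with h | h
    exacts [hBA h.1, h.1.1]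
  · right
    rw [not_lt] at hsm
    rcases hxs' with ⟨h1, h2⟩ | ⟨⟨h1, h2⟩, h3⟩
    · refine ⟨hBA h1, ?_⟩
      have h4 : (d n).1 x ≤ e.1 x / 2 := not_lt.1 fun h => h2 ⟨hBA h1, h⟩
      rw [hx, indicator_of_mem h1, abs_sub_comm]
      exact le_trans (by linarith) (le_abs_self _)
    · refine ⟨h1, ?_⟩
      rw [hx, indicator_of_notMem h3, sub_zero]
      simp only [mem_ofPred_eq] at h2
      exact le_trans (by linarith) (le_abs_self _)

/-! ### From sets of finite measure back to the whole space. -/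

theorem IsOrderContinuous.separableSpace_of_measuredSets [SigmaFinite μ]
    (hoc : X.IsOrderContinuous) (hod : X.IsOrderDense)
    (h : ∀ A : Set Ω, MeasurableSet A → μ A < ∞ →
      TopologicalSpace.SeparableSpace {B : MeasuredSets μ // (B : Set Ω) ⊆ A}) :
    TopologicalSpace.SeparableSpace X.carrier := by
  obtain ⟨e, he⟩ := hod.exists_isStrictlyPositive
  refine hoc.separableSpace_of_indicator he ?_
  have hA := measurableSet_spanningSets μ
  have hsep : ∀ n, TopologicalSpace.IsSeparable (range fun
      B : {B : MeasuredSets μ // (B : Set Ω) ⊆ spanningSets μ n} => indicator e B.1.2) := fun n => by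
    have := h _ (hA n) (measure_spanningSets_lt_top μ n)
    exact TopologicalSpace.isSeparable_range
      ((hoc.continuous_indicator e).comp continuous_subtype_val)
  -- Each `χ_B e` is the norm limit of `χ_{B ∩ A n} e` along the exhaustion `A n`, so the countable
  -- union of separable pieces is dense enough.
  refine (TopologicalSpace.IsSeparable.iUnion hsep).closure.mono ?_
  rintro _ ⟨B, rfl⟩
  refine mem_closure_of_tendsto (hoc.tendsto_indicator (indicator e B.2) hA
    (monotone_spanningSets μ) (iUnion_spanningSets μ)) (.of_forall fun n => mem_iUnion.2 ⟨n, ?_⟩)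
  refine ⟨⟨⟨B.1 ∩ spanningSets μ n, B.2.inter (hA n)⟩, inter_subset_right⟩, ext_ae ?_⟩
  filter_upwards [coeFn_indicator e B.2, coeFn_indicator (indicator e B.2) (hA n),
    coeFn_indicator e (B.2.inter (hA n))] with x h1 h2 h3
  rw [h2, h3, inter_comm, ← indicator_indicator]
  simp only [Set.indicator, h1]

theorem IsOrderContinuous.separableSpace_of_restrictTo [SigmaFinite μ]
    (hoc : X.IsOrderContinuous) (h : ∀ A : Set Ω, MeasurableSet A → μ A < ∞ →
      TopologicalSpace.SeparableSpace (X.restrictTo A)) :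
    TopologicalSpace.SeparableSpace X.carrier := by
  have hA := measurableSet_spanningSets μ
  have hsep : ∀ n, TopologicalSpace.IsSeparable (X.restrictTo (spanningSets μ n)) := fun n => by
    have := h _ (hA n) (measure_spanningSets_lt_top μ n)
    exact .of_subtype _
  refine TopologicalSpace.isSeparable_univ_iff.1
    ((TopologicalSpace.IsSeparable.iUnion hsep).closure.mono fun f _ => ?_)
  exact mem_closure_of_tendsto (hoc.tendsto_indicator f hA (monotone_spanningSets μ)
    (iUnion_spanningSets μ)) (.of_forall fun n => mem_iUnion.2 ⟨n, f, coeFn_indicator f (hA n)⟩)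

end BanachFunctionSpace

/-! ### The equivalences. -/

theorem mainTheorem4 {Ω : Type*} [MeasurableSpace Ω] (μ : Measure Ω)
    (hμ : IsSemifiniteMeasure μ) (X : BanachFunctionSpace μ)
    (hoc : X.IsOrderContinuous) (hod : X.IsOrderDense) :
    List.TFAE [
      TopologicalSpace.SeparableSpace X.carrier,
      @TopologicalSpace.SeparableSpace X.carrier X.localMeasureTopology,
      SigmaFinite μ ∧ ∀ A : Set Ω, MeasurableSet A → μ A < ∞ →
        TopologicalSpace.SeparableSpace {B : MeasuredSets μ // (B : Set Ω) ⊆ A},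
      SigmaFinite μ ∧ ∀ A : Set Ω, MeasurableSet A → μ A < ∞ →
        TopologicalSpace.SeparableSpace (X.restrictTo A),
      (∃ f : X.carrier, X.IsStrictlyPositive f) ∧
        ∀ f : X.carrier, X.IsStrictlyPositive f →
          TopologicalSpace.SeparableSpace (X.components f)] := by
  tfae_have 1 → 2 := fun h => by
    exact @DenseRange.separableSpace _ _ _ h X.localMeasureTopology id
      (@Function.Surjective.denseRange _ X.localMeasureTopology _ _ Function.surjective_id)
      (BanachFunctionSpace.continuous_id_localMeasureTopology X)
  tfae_have 2 → 3 := fun h => by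
    have := hoc.sigmaFinite hμ hod h
    obtain ⟨e, he⟩ := hod.exists_isStrictlyPositive
    exact ⟨this, fun A hA hA' =>
      BanachFunctionSpace.separableSpace_measuredSets_of_localMeasureTopology h he hA hA'⟩
  tfae_have 3 → 1 := fun ⟨_, h⟩ => hoc.separableSpace_of_measuredSets hod h
  -- Separability is hereditary here because the norm topology is metrizable.
  have sep : TopologicalSpace.SeparableSpace X.carrier → ∀ s : Set X.carrier,
      TopologicalSpace.SeparableSpace s := fun _ s =>
    (TopologicalSpace.IsSeparable.of_separableSpace s).separableSpace
  have sigma : TopologicalSpace.SeparableSpace X.carrier → SigmaFinite μ :=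
    fun h => (tfae_2_to_3 (tfae_1_to_2 h)).1
  tfae_have 1 → 4 := fun h => ⟨sigma h, fun A _ _ => sep h _⟩
  tfae_have 4 → 1 := fun ⟨_, h⟩ => hoc.separableSpace_of_restrictTo h
  tfae_have 1 → 5 := fun h =>
    have := sigma h
    ⟨hod.exists_isStrictlyPositive, fun f _ => sep h _⟩
  tfae_have 5 → 1 := fun ⟨⟨e, he⟩, h⟩ => by
    have := h e he
    refine hoc.separableSpace_of_indicator he
      ((TopologicalSpace.IsSeparable.of_subtype (X.components e)).mono ?_)
    rintro _ ⟨B, rfl⟩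
    exact BanachFunctionSpace.indicator_mem_components he B.2
  tfae_finish
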